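/- For an integer $n\ge 1$ let $\delta_n^*\colon\mathbb{R}^n\to\mathbb{R}$, $\delta_n^*(x)=x_1+\dots+x_n$, let $M_n=\mathbb{Z}^n\cap\ker\delta_n^*$, a lattice in $(M_n)_{\mathbb{R}}=\ker\delta_n^*$, and let $\Delta_1=[0,1]$. Let $Q(\Delta_1,n)\subseteq\ker\delta_n^*$ be the fiber polytope of the polytope fibration $\delta_n^*\colon\Delta_1^n\to n\Delta_1$, i.e. the set of all integrals $\int_{[0,n]}\gamma(y)\,dy$ over continuous sections $\gamma\colon[0,n]\to[0,1]^n$ of $\delta_n^*$, translated into $\ker\delta_n^*$ by subtracting $n/2$ from every coordinate. Two polytopes of the same dimension in one real vector space are \emph{normally equivalent} if there is an isomorphism between their face posets under which the affine hulls of corresponding faces are translates of each other, and their inner normal fans coincide. Let $\pi\colon M\to\Lambda$ be a surjective map of lattices with real extension $\pi_{\mathbb{R}}$, and let $R_1,\dots,R_k\subseteq M_{\mathbb{R}}$ be pairwise normally equivalent lattice polytopes such that each $\pi_{\mathbb{R}}(R_j)$ is a single lattice point $v_j\in\Lambda$. Then $R=\mathrm{Conv}(R_1,\dots,R_k)$,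 with the map $\pi_{\mathbb{R}}|_R\colon R\to\mathrm{Conv}(v_1,\dots,v_k)$, is called a \emph{generalized $\pi$-twisted Cayley sum} of $R_1,\dots,R_k$ over $\mathrm{Conv}(v_1,\dots,v_k)$. \textbf{Corollary.} Let $m\ge1$. The polytope $Q(\Delta_1,m+1)$ is $m$-dimensional and is a translate of the permutohedron, the convex hull of all permutations of $(1,\dots,m+1)$. Moreover, for each $i\in\{1,\dots,m+1\}$ let $\pi_i\colon M_{m+1}\to\mathbb{Z}$ be the surjection $\pi_i(x)=\sum_{j\ne i}x_j$, and identify $\ker\delta_m^*$ with $\ker(\pi_i)_{\mathbb{R}}$ by inserting a zero as $i$-th coordinate. Then a suitable translate of $Q(\Delta_1,m+1)$ in $(M_{m+1})_{\mathbb{R}}$ is a generalized $\pi_i$-twisted Cayley sum over $m\Delta_1=[0,m]$ of $m+1$ lattice polytopes $R_1,\dots,R_{m+1}$, each normally equivalent to $Q(\Delta_1,m)$, such that \[\{\pi_i(R_1),\dots,\pi_i(R_{m+1})\}=m\Delta_1\cap\mathbb{Z}=\{0,1,\dots,m\}.\] -/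

import Mathlib

open scoped Pointwise

noncomputable section

/-! ### Lattice polytopes, faces, normal fans, normal equivalence -/

section Polytopes

variable {E : Type*} [AddCommGroup E] [Module ℝ E]

/-- `P` is a (nonempty) lattice polytope with respect to the lattice `M`. -/
def IsLatticePolytope (M : Submodule ℤ E) (P : Set E) : Prop :=
  ∃ S : Finset E, S.Nonempty ∧ (∀ x ∈ S, x ∈ M) ∧ P = convexHull ℝ (S : Set E)

/-- The nonempty faces of a polytope `P`: the nonempty sets of points of `P` where some linear
functional attains its minimum over `P` (the functional `0` gives `P` itself). -/
def IsPolytopeFace (P F : Set E) : Prop :=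
  F.Nonempty ∧ ∃ u : Module.Dual ℝ E, F = {x ∈ P | ∀ y ∈ P, u x ≤ u y}

/-- The inner normal cone of `P` along `F`: the functionals minimized over `P` at all points
of `F`. -/
def innerNormalCone (P F : Set E) : Set (Module.Dual ℝ E) :=
  {u | ∀ x ∈ F, ∀ y ∈ P, u x ≤ u y}

/-- The inner normal fan of `P`, as the collection of its cones. -/
def innerNormalFan (P : Set E) : Set (Set (Module.Dual ℝ E)) :=
  {C | ∃ F, IsPolytopeFace P F ∧ C = innerNormalCone P F}

/-- The dimension of a polytope. -/
def polytopeDim (P : Set E) : ℕ := Module.finrank ℝ (affineSpan ℝ P).direction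

/-- Strict combinatorial isomorphism: same dimension, and an isomorphism of the face posets such
that the affine hulls of corresponding faces are translates of each other. -/
def StrictlyCombIso (P Q : Set E) : Prop :=
  polytopeDim P = polytopeDim Q ∧
    ∃ φ : {F : Set E // IsPolytopeFace P F} ≃o {F : Set E // IsPolytopeFace Q F},
      ∀ F, ∃ t : E, (affineSpan ℝ (φ F : Set E) : Set E) = t +ᵥ (affineSpan ℝ (F : Set E) : Set E)

/-- Normal equivalence: strictly combinatorially isomorphic with the same inner normal fan. -/
def NormallyEquivalent (P Q : Set E) : Prop :=
  StrictlyCombIso P Q ∧ innerNormalFan P = innerNormalFan Q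

end Polytopes

/-! ### Generalized twisted Cayley sums -/

/-- `T = Conv(R₁, …, R_k)` is, via `π`, a generalized `π`-twisted Cayley sum of `R₁, …, R_k`
over the polytope `B`.  The lattices are given as full lattices `M ⊆ E = M_ℝ` and
`Λ ⊆ F = Λ_ℝ`, and the surjection `M → Λ` through its real extension `π : E → F`. -/
structure IsGenTwistedCayleySum
    {E : Type*} [NormedAddCommGroup E] [NormedSpace ℝ E]
    {F : Type*} [NormedAddCommGroup F] [NormedSpace ℝ F]
    (M : Submodule ℤ E) (Λ : Submodule ℤ F) (π : E →ₗ[ℝ] F)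
    {k : ℕ} (R : Fin k → Set E) (T : Set E) (B : Set F) : Prop where
  discrete_M : DiscreteTopology M
  span_M : Submodule.span ℝ (M : Set E) = ⊤
  discrete_Λ : DiscreteTopology Λ
  span_Λ : Submodule.span ℝ (Λ : Set F) = ⊤
  map_eq : π '' (M : Set E) = (Λ : Set F)
  isLatticePolytope : ∀ j, IsLatticePolytope M (R j)
  normallyEquivalent : ∀ i j, NormallyEquivalent (R i) (R j)
  total : T = convexHull ℝ (⋃ j, R j)
  base : ∃ v : Fin k → F, (∀ j, v j ∈ Λ ∧ π '' R j = {v j}) ∧ B = convexHull ℝ (Set.range v)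

/-! ### Fiber polytopes and `Q(P, n)` -/

/-- The fiber polytope of the polytope fibration `π : P → π(P)`: the set of the integrals over
`π(P)` of the continuous sections of `π` with values in `P`.  (No division by the volume of
`π(P)`, i.e. this is the Minkowski integral of the fibers.) -/
def fiberPolytope {E F : Type*} [NormedAddCommGroup E] [NormedSpace ℝ E]
    [NormedAddCommGroup F] [NormedSpace ℝ F] [MeasureTheory.MeasureSpace F]
    (π : E →ₗ[ℝ] F) (P : Set E) : Set E :=
  {x | ∃ γ : F → E, ContinuousOn γ (π '' P) ∧ (∀ y ∈ π '' P, γ y ∈ P ∧ π (γ y) = y) ∧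
    x = ∫ y in π '' P, γ y}

section QPoly

variable (V : Type*) [NormedAddCommGroup V] [NormedSpace ℝ V]

/-- The sum map `δ* : Vⁿ → V`, dual to the diagonal embedding. -/
def deltaStar (n : ℕ) : (Fin n → V) →ₗ[ℝ] V := ∑ i, LinearMap.proj i

/-- The space `ker δ*`, i.e. the dual of the quotient of `(V*)ⁿ` by the diagonal; for `V = ℝ`, the
vectors of `ℝⁿ` with coordinate sum zero. -/
abbrev charSpace (n : ℕ) : Submodule ℝ (Fin n → V) := LinearMap.ker (deltaStar V n)

variable {V}

/-- The polytope `Q(P, n)` in `ker δ*`: the fiber polytope of `δ* : Pⁿ → nP`, moved into `ker δ*`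
by subtracting from all the `n` coordinates the same vector `c`.  (All points of the fiber polytope
have coordinate sum `∫_{nP} y dy = n c`.) -/
def polyQ [MeasureTheory.MeasureSpace V] (P : Set V) (n : ℕ) : Set (charSpace V n) :=
  let Pn : Set (Fin n → V) := Set.univ.pi fun _ => P
  let c : V := (n : ℝ)⁻¹ • ∫ y in deltaStar V n '' Pn, y
  {x | (x : Fin n → V) + (fun _ => c) ∈ fiberPolytope (deltaStar V n) Pn}

/-- The map `π_i : ker δ*_{m+1} → V`: forget the `i`-th coordinate (this identifies `ker δ*_{m+1}`
with `Vᵐ`), then apply `δ*_m`. -/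
def cayleyProj {m : ℕ} (i : Fin (m + 1)) : charSpace V (m + 1) →ₗ[ℝ] V :=
  deltaStar V m ∘ₗ LinearMap.funLeft ℝ V i.succAbove ∘ₗ (charSpace V (m + 1)).subtype

/-- The inclusion `ker δ*_m → ker δ*_{m+1}` that inserts a zero as `i`-th coordinate; its image is
the kernel of `cayleyProj i`. -/
def insertZero {m : ℕ} (i : Fin (m + 1)) (x : charSpace V m) : charSpace V (m + 1) :=
  ⟨i.insertNth 0 (x : Fin m → V), by
    have hx : ∑ j, (x : Fin m → V) j = 0 := by
      have h := LinearMap.mem_ker.mp x.2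
      simpa only [deltaStar, LinearMap.sum_apply, LinearMap.proj_apply] using h
    simpa [deltaStar, Fin.sum_univ_succAbove _ i] using hx⟩

end QPoly

/-! ### The case of the segment -/

/-- The one-dimensional simplex `Δ₁ = [0, 1] ⊆ ℝ`. -/
def Delta1 : Set ℝ := Set.Icc 0 1

/-- The lattice `ℤ ⊆ ℝ`. -/
def intLattice : Submodule ℤ ℝ := LinearMap.range (Algebra.linearMap ℤ ℝ)

/-- The lattice of integer vectors with coordinate sum zero. -/
def charLattice (n : ℕ) : Submodule ℤ (charSpace ℝ n) where
  carrier := {x | ∀ i, (x : Fin n → ℝ) i ∈ intLattice}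
  add_mem' hx hy i := intLattice.add_mem (hx i) (hy i)
  zero_mem' _ := intLattice.zero_mem
  smul_mem' c _ hx i := intLattice.smul_mem c (hx i)

/-- The standard permutohedron: the convex hull of the permutations of `(1, …, n)`. -/
def permutohedron (n : ℕ) : Set (Fin n → ℝ) :=
  convexHull ℝ (Set.range fun (σ : Equiv.Perm (Fin n)) (i : Fin n) => ((σ i : ℕ) : ℝ) + 1)

end

/-! To minimize a linear functional with coefficients `c` over the fiber polytope, it suffices to
minimize it over every fiber of the cube. The optimum in the fiber of sum `y` is greedy: fill the
coordinates one at a time, cheapest first. One filling order is optimal for all `y` at once, so a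
single monotone edge path (`cubePath`) minimizes the integral, and its integral has coordinates `σ k
+ 1/2` (`integral_cubePath`). Separation by a hyperplane, together with convexity of the set of
integrals, identifies the fiber polytope with a translated permutohedron (`fiberPolytope_cube`).

For the Cayley structure, group the vertices by `j = σ i`. The other coordinates then run through
all arrangements of `(1, …, m + 1)` with `j + 1` left out, up to a fixed shift, so each group spans
an orbit polytope of the symmetric group on `m` letters, and so does the inserted copy of `Q(Δ₁,
m)`. All of these are images under the same linear map `balance i` of orbits of strictly increasing
vectors.

Such orbit polytopes are normally equivalent (`normallyEquivalent_orbit`). By the equality case of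
the rearrangement inequality, the permutations minimizing a functional are those ordered oppositely
to its coefficients, whatever the increasing vector (`minIdx_orbit`). The directions of the
corresponding face are equally independent of that vector (`vectorSpan_orbit`). Since faces and
normal cones are determined by sets of minimizing indices, `normallyEquivalent_convexHull_range`
applies. -/

open scoped Pointwise

noncomputable section

/-! ### Normal equivalence of convex hulls of finite families -/

section Families

variable {E : Type*} [AddCommGroup E] [Module ℝ E] {ι : Type*}

/-- The indices at which `u` attains its minimum over the family `v`. -/
def minIdx (u : Module.Dual ℝ E) (v : ι → E) : Set ι := {i | ∀ j, u (v i) ≤ u (v j)}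

theorem le_of_mem_convexHull {u : Module.Dual ℝ E} {s : Set E} {c : ℝ} (h : ∀ x ∈ s, c ≤ u x)
    {x : E} (hx : x ∈ convexHull ℝ s) : c ≤ u x :=
  convexHull_min (t := {x | c ≤ u x}) h (convex_halfSpace_ge u.isLinear c) hx

theorem lt_of_mem_convexHull {u : Module.Dual ℝ E} {s : Set E} {c : ℝ} (h : ∀ x ∈ s, c < u x)
    {x : E} (hx : x ∈ convexHull ℝ s) : c < u x :=
  convexHull_min (t := {x | c < u x}) h (convex_halfSpace_gt u.isLinear c) hx

theorem mem_minIdx_iff {u : Module.Dual ℝ E} {v : ι → E} {i : ι} :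
    i ∈ minIdx u v ↔ ∀ y ∈ convexHull ℝ (Set.range v), u (v i) ≤ u y := by
  constructor
  · intro h y hy
    exact le_of_mem_convexHull (by rintro _ ⟨j, rfl⟩; exact h j) hy
  · intro h j
    exact h _ (subset_convexHull ℝ _ ⟨j, rfl⟩)

theorem minIdx_nonempty [Finite ι] [Nonempty ι] (u : Module.Dual ℝ E) (v : ι → E) :
    (minIdx u v).Nonempty :=
  Finite.exists_min fun i => u (v i)

/-- The face of the convex hull of a family on which `u` is minimal is the convex hull of the
members of the family on which `u` is minimal. -/
theorem face_convexHull_range [Finite ι] [Nonempty ι] (u : Module.Dual ℝ E) (v : ι → E) :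
    {x ∈ convexHull ℝ (Set.range v) | ∀ y ∈ convexHull ℝ (Set.range v), u x ≤ u y} =
      convexHull ℝ (v '' minIdx u v) := by
  obtain ⟨i₀, hi₀⟩ := minIdx_nonempty u v
  apply Set.Subset.antisymm
  · rintro x ⟨hx, hmin⟩
    have hxle : u x ≤ u (v i₀) := hmin _ (subset_convexHull ℝ _ ⟨i₀, rfl⟩)
    -- Writing a point of the hull as a combination of a minimizing and a non-minimizing part needs
    -- both parts to be nonempty.
    rcases (minIdx u v)ᶜ.eq_empty_or_nonempty with hc | hc
    · rw [Set.compl_empty_iff] at hc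
      rwa [hc, Set.image_univ]
    · rw [← Set.image_univ, ← Set.union_compl_self (minIdx u v), Set.image_union,
        convexHull_union ((minIdx_nonempty u v).image v) (hc.image v)] at hx
      obtain ⟨a, ha, b, hb, α, β, hα, hβ, hαβ, rfl⟩ := mem_convexJoin.1 hx
      have h1 : u (v i₀) ≤ u a :=
        le_of_mem_convexHull (by rintro _ ⟨j, -, rfl⟩; exact hi₀ j) ha
      have h2 : u (v i₀) < u b := by
        refine lt_of_mem_convexHull ?_ hb
        rintro _ ⟨j, hj, rfl⟩
        by_contra! hlt
        exact hj fun k => hlt.trans (hi₀ k)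
      have hβ0 : β = 0 := by
        by_contra hne
        have hβ' : 0 < β := lt_of_le_of_ne hβ (Ne.symm hne)
        simp only [map_add, map_smul, smul_eq_mul] at hxle
        have e : α = 1 - β := by linarith
        subst e
        nlinarith [mul_pos hβ' (sub_pos.2 h2), mul_nonneg hα (sub_nonneg.2 h1)]
      have hα1 : α = 1 := by linarith
      simpa [hβ0, hα1] using ha
  · intro x hx
    refine ⟨convexHull_mono (Set.image_subset_range _ _) hx, fun y hy => ?_⟩
    have h1 : u (v i₀) ≤ u y := mem_minIdx_iff.1 hi₀ y hy
    have h2 : -u (v i₀) ≤ (-u) x := by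
      refine le_of_mem_convexHull ?_ hx
      rintro _ ⟨j, hj, rfl⟩
      simpa using hj i₀
    rw [LinearMap.neg_apply] at h2
    linarith

/-- The convex hull of the members of the family `w` whose counterparts in the family `v` lie
in `F`. -/
def transferFace (v w : ι → E) (F : Set E) : Set E := convexHull ℝ (w '' {i | v i ∈ F})

theorem transferFace_mono (v w : ι → E) : Monotone (transferFace v w) := fun _ _ h =>
  convexHull_mono (Set.image_mono fun _ hi => h hi)

theorem exists_affineSpan_eq_vadd {v w : ι → E} {I : Set ι} (hI : I.Nonempty)
    (h : vectorSpan ℝ (v '' I) = vectorSpan ℝ (w '' I)) :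
    ∃ t : E, (affineSpan ℝ (w '' I) : Set E) = t +ᵥ (affineSpan ℝ (v '' I) : Set E) := by
  obtain ⟨i, hi⟩ := hI
  have hv : v i ∈ affineSpan ℝ (v '' I) := subset_affineSpan ℝ _ ⟨i, hi, rfl⟩
  have hw : w i ∈ affineSpan ℝ (w '' I) := subset_affineSpan ℝ _ ⟨i, hi, rfl⟩
  refine ⟨w i - v i, Set.ext fun x => ?_⟩
  rw [Set.mem_vadd_set_iff_neg_vadd_mem, SetLike.mem_coe, SetLike.mem_coe,
    ← AffineSubspace.vsub_right_mem_direction_iff_mem hw,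
    ← AffineSubspace.vsub_right_mem_direction_iff_mem hv, direction_affineSpan,
    direction_affineSpan, h]
  have : (-(w i - v i) +ᵥ x) -ᵥ v i = x -ᵥ w i := by simp only [vadd_eq_add, vsub_eq_sub]; abel
  rw [this]

theorem polytopeDim_convexHull (s : Set E) :
    polytopeDim (convexHull ℝ s) = Module.finrank ℝ (vectorSpan ℝ s) := by
  rw [polytopeDim, affineSpan_convexHull, direction_affineSpan]

variable [Finite ι] [Nonempty ι]

/-- A face remembers its minimizing index set, so `transferFace` depends on the face alone and not
on the functional that cuts it out. -/
theorem setOf_mem_face (u : Module.Dual ℝ E) (v : ι → E) :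
    {i | v i ∈ convexHull ℝ (v '' minIdx u v)} = minIdx u v := by
  ext i
  rw [← face_convexHull_range]
  simp only [Set.mem_ofPred_eq, mem_minIdx_iff]
  exact ⟨fun h => h.2, fun h => ⟨subset_convexHull ℝ _ ⟨i, rfl⟩, h⟩⟩

theorem isPolytopeFace_iff {v : ι → E} {F : Set E} :
    IsPolytopeFace (convexHull ℝ (Set.range v)) F ↔
      ∃ u : Module.Dual ℝ E, F = convexHull ℝ (v '' minIdx u v) := by
  constructor
  · rintro ⟨-, u, rfl⟩
    exact ⟨u, face_convexHull_range u v⟩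
  · rintro ⟨u, rfl⟩
    exact ⟨((minIdx_nonempty u v).image v).convexHull, u, (face_convexHull_range u v).symm⟩

theorem transferFace_face {v w : ι → E} (hmin : ∀ u, minIdx u v = minIdx u w)
    (u : Module.Dual ℝ E) :
    transferFace v w (convexHull ℝ (v '' minIdx u v)) = convexHull ℝ (w '' minIdx u w) := by
  rw [transferFace, setOf_mem_face, hmin]

theorem isPolytopeFace_transferFace {v w : ι → E} (hmin : ∀ u, minIdx u v = minIdx u w)
    {F : Set E} (hF : IsPolytopeFace (convexHull ℝ (Set.range v)) F) :
    IsPolytopeFace (convexHull ℝ (Set.range w)) (transferFace v w F) := by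
  obtain ⟨u, rfl⟩ := isPolytopeFace_iff.1 hF
  exact isPolytopeFace_iff.2 ⟨u, transferFace_face hmin u⟩

theorem transferFace_transferFace {v w : ι → E} (hmin : ∀ u, minIdx u v = minIdx u w)
    {F : Set E} (hF : IsPolytopeFace (convexHull ℝ (Set.range v)) F) :
    transferFace w v (transferFace v w F) = F := by
  obtain ⟨u, rfl⟩ := isPolytopeFace_iff.1 hF
  rw [transferFace_face hmin, transferFace_face fun u => (hmin u).symm]

/-- The isomorphism of face posets between two families with the same minimizing indices. -/
def faceIso {v w : ι → E} (hmin : ∀ u, minIdx u v = minIdx u w) :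
    {F : Set E // IsPolytopeFace (convexHull ℝ (Set.range v)) F} ≃o
      {F : Set E // IsPolytopeFace (convexHull ℝ (Set.range w)) F} :=
  Equiv.toOrderIso
    { toFun := fun F => ⟨transferFace v w F, isPolytopeFace_transferFace hmin F.2⟩
      invFun := fun F =>
        ⟨transferFace w v F, isPolytopeFace_transferFace (fun u => (hmin u).symm) F.2⟩
      left_inv := fun F => Subtype.ext (transferFace_transferFace hmin F.2)
      right_inv := fun F =>
        Subtype.ext (transferFace_transferFace (fun u => (hmin u).symm) F.2) }
    (fun _ _ h => transferFace_mono v w h) (fun _ _ h => transferFace_mono w v h)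

/-- Expresses normal cones purely through minimizing indices, so that families sharing these indices
share their fans. -/
theorem innerNormalCone_face {v : ι → E} (u : Module.Dual ℝ E) :
    innerNormalCone (convexHull ℝ (Set.range v)) (convexHull ℝ (v '' minIdx u v)) =
      {u' | minIdx u v ⊆ minIdx u' v} := by
  ext u'
  constructor
  · intro h i hi
    exact mem_minIdx_iff.2 (h _ (subset_convexHull ℝ _ ⟨i, hi, rfl⟩))
  · intro h x hx
    have hx' := convexHull_mono (Set.image_mono h) hx
    rw [← face_convexHull_range] at hx'
    exact hx'.2

theorem innerNormalFan_subset {v w : ι → E} (hmin : ∀ u, minIdx u v = minIdx u w) :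
    innerNormalFan (convexHull ℝ (Set.range v)) ⊆ innerNormalFan (convexHull ℝ (Set.range w)) := by
  rintro _ ⟨F, hF, rfl⟩
  obtain ⟨u, rfl⟩ := isPolytopeFace_iff.1 hF
  refine ⟨_, isPolytopeFace_iff.2 ⟨u, rfl⟩, ?_⟩
  rw [innerNormalCone_face, innerNormalCone_face]
  simp only [hmin]

/-- Two families with the same minimizing indices and parallel faces have normally equivalent
convex hulls. -/
theorem normallyEquivalent_convexHull_range {v w : ι → E}
    (hmin : ∀ u, minIdx u v = minIdx u w)
    (hspan : ∀ u, vectorSpan ℝ (v '' minIdx u v) = vectorSpan ℝ (w '' minIdx u w)) :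
    NormallyEquivalent (convexHull ℝ (Set.range v)) (convexHull ℝ (Set.range w)) := by
  refine ⟨⟨?_, faceIso hmin, ?_⟩, ?_⟩
  -- The zero functional cuts out the whole polytope, so equality of dimensions is a case of
  -- `hspan`.
  · have h0 : ∀ v : ι → E, minIdx 0 v = Set.univ := fun v => by ext; simp [minIdx]
    have := hspan 0
    rw [h0, h0, Set.image_univ, Set.image_univ] at this
    rw [polytopeDim_convexHull, polytopeDim_convexHull, this]
  · rintro ⟨F, hF⟩
    obtain ⟨u, rfl⟩ := isPolytopeFace_iff.1 hF
    change ∃ t : E, (affineSpan ℝ (transferFace v w _) : Set E) = t +ᵥ _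
    rw [transferFace_face hmin, affineSpan_convexHull, affineSpan_convexHull, ← hmin u]
    exact exists_affineSpan_eq_vadd (minIdx_nonempty u v) (by rw [hspan, hmin])
  · exact (innerNormalFan_subset hmin).antisymm (innerNormalFan_subset fun u => (hmin u).symm)

end Families

/-! ### Orbit polytopes of the symmetric group -/

section Orbits

variable {E : Type*} [AddCommGroup E] [Module ℝ E] {n : ℕ}

theorem exists_perm_antivary (c : Fin n → ℝ) : ∃ σ : Equiv.Perm (Fin n), Antivary c σ := by
  -- The inverse of the sorting permutation gives the rank of each entry of `c`; reversing the ranks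
  -- opposes the order.
  refine ⟨(Tuple.sort c).symm.trans Fin.revPerm, fun i j hij => ?_⟩
  have h : (Tuple.sort c).symm j ≤ (Tuple.sort c).symm i := by
    have := hij.le
    simpa using this
  simpa using Tuple.monotone_sort c h

theorem antivary_comp_iff {c : Fin n → ℝ} {a : Fin n → ℝ} (ha : StrictMono a)
    {σ : Equiv.Perm (Fin n)} : Antivary c (a ∘ σ) ↔ Antivary c σ := by
  simp only [Antivary, Function.comp_apply, ha.lt_iff_lt]

/-- The rearrangement inequality, as a description of the minimizing permutations. -/
theorem forall_sum_mul_le_iff_antivary {c a : Fin n → ℝ} (ha : StrictMono a)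
    (σ : Equiv.Perm (Fin n)) :
    (∀ τ : Equiv.Perm (Fin n), ∑ k, c k * a (σ k) ≤ ∑ k, c k * a (τ k)) ↔ Antivary c σ := by
  constructor
  · intro h
    obtain ⟨τ, hτ⟩ := exists_perm_antivary c
    have hτ' := (antivary_comp_iff ha).2 hτ
    -- Both `σ` and the opposite order `τ` attain the minimum, so the equality case of rearrangement
    -- applies to `σ`.
    have e : ∑ k, c k * (a ∘ τ) ((σ.trans τ.symm) k) = ∑ k, c k * (a ∘ τ) k := by
      refine le_antisymm ?_ hτ'.sum_mul_le_sum_mul_comp_perm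
      simpa using h τ
    rw [hτ'.sum_mul_eq_sum_mul_comp_perm_iff] at e
    have e' : (a ∘ τ) ∘ (σ.trans τ.symm) = a ∘ σ := by ext; simp
    rw [e'] at e
    exact (antivary_comp_iff ha).1 e
  · intro h τ
    simpa using ((antivary_comp_iff ha).2 h).sum_mul_le_sum_mul_comp_perm (σ := τ.trans σ.symm)

/-- Permutations varying oppositely to `c` differ by a permutation that preserves `c`. -/
theorem apply_symm_trans_of_antivary {c : Fin n → ℝ} {σ τ : Equiv.Perm (Fin n)}
    (hσ : Antivary c σ) (hτ : Antivary c τ) (k : Fin n) : c (σ.symm (τ k)) = c k := by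
  have h : ∀ ρ : Equiv.Perm (Fin n), Antivary c ρ → Antitone (c ∘ ρ.symm) := fun ρ hρ i j hij => by
    rcases hij.eq_or_lt with rfl | hlt
    · exact le_rfl
    · exact hρ (by simpa using hlt)
  -- Both permutations sort `c` decreasingly, and the sorted tuple is unique.
  have := congrFun (Tuple.unique_antitone (h σ hσ) (h τ hτ)) (τ k)
  simpa using this

/-- The coefficients of `u ∘ L` in the standard basis. -/
theorem dual_apply_eq_sum (L : (Fin n → ℝ) →ₗ[ℝ] E) (u : Module.Dual ℝ E) (x : Fin n → ℝ) :
    u (L x) = ∑ k, u (L (Pi.single k 1)) * x k := by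
  rw [← LinearMap.comp_apply, LinearMap.pi_apply_eq_sum_univ (u ∘ₗ L) x]
  refine Finset.sum_congr rfl fun k _ => ?_
  rw [smul_eq_mul, mul_comm, LinearMap.comp_apply]
  congr 4
  ext j
  simp [Pi.single_apply, eq_comm]

theorem minIdx_orbit (L : (Fin n → ℝ) →ₗ[ℝ] E) (p : E) {a : Fin n → ℝ} (ha : StrictMono a)
    (u : Module.Dual ℝ E) :
    minIdx u (fun σ : Equiv.Perm (Fin n) => p + L (a ∘ σ)) =
      {σ : Equiv.Perm (Fin n) | Antivary (fun k => u (L (Pi.single k 1))) σ} := by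
  ext σ
  rw [Set.mem_ofPred_eq, ← forall_sum_mul_le_iff_antivary ha]
  simp only [minIdx, Set.mem_ofPred_eq, map_add, add_le_add_iff_left]
  have h : ∀ τ : Equiv.Perm (Fin n),
      u (L (a ∘ τ)) = ∑ k, u (L (Pi.single k 1)) * a (τ k) := fun τ => dual_apply_eq_sum L u _
  simp only [h]

/-- Minimizing permutations differ only by shuffling positions where `c` is constant. Conversely,
swapping two such positions moves the vertex by a nonzero multiple of the image of the difference of
their basis vectors. The right-hand side involves neither `a` nor `p`. -/
theorem vectorSpan_orbit (L : (Fin n → ℝ) →ₗ[ℝ] E) (p : E) {a : Fin n → ℝ} (ha : StrictMono a)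
    (c : Fin n → ℝ) :
    vectorSpan ℝ ((fun σ : Equiv.Perm (Fin n) => p + L (a ∘ σ)) ''
        {σ : Equiv.Perm (Fin n) | Antivary c σ}) =
      Submodule.span ℝ
        {x | ∃ k l, c k = c l ∧ x = L (Pi.single k 1 - Pi.single l 1)} := by
  apply le_antisymm
  · rw [vectorSpan_def, Submodule.span_le]
    rintro _ ⟨_, ⟨τ, hτ, rfl⟩, _, ⟨σ, hσ, rfl⟩, rfl⟩
    -- The value `a (τ k)` sits at position `k` in `a ∘ τ` and at position `σ.symm (τ k)` in `a ∘
    -- σ`; `c` agrees at these two positions.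
    have key : a ∘ τ - a ∘ σ =
        ∑ k, a (τ k) • (Pi.single k 1 - Pi.single (σ.symm (τ k)) 1 : Fin n → ℝ) := by
      simp only [smul_sub, Finset.sum_sub_distrib]
      congr 1
      · exact pi_eq_sum_univ' _
      · rw [pi_eq_sum_univ' (a ∘ σ), ← Equiv.sum_comp (τ.trans σ.symm)]
        simp
    have : (p + L (a ∘ τ)) -ᵥ (p + L (a ∘ σ)) = L (a ∘ τ - a ∘ σ) := by
      rw [vsub_eq_sub, add_sub_add_left_eq_sub, map_sub]
    simp only [this, key, map_sum, map_smul]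
    refine Submodule.sum_mem _ fun k _ => Submodule.smul_mem _ _ (Submodule.subset_span ?_)
    exact ⟨k, _, (apply_symm_trans_of_antivary hσ hτ k).symm, rfl⟩
  · rw [Submodule.span_le]
    rintro _ ⟨k, l, hkl, rfl⟩
    obtain rfl | hne := eq_or_ne k l
    · simp
    obtain ⟨σ, hσ⟩ := exists_perm_antivary c
    have hτ : (Equiv.swap k l).trans σ ∈ {σ : Equiv.Perm (Fin n) | Antivary c σ} := by
      have hc : ∀ j, c (Equiv.swap k l j) = c j := fun j => by
        rcases eq_or_ne j k with rfl | h1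
        · simp [hkl]
        rcases eq_or_ne j l with rfl | h2
        · simp [hkl]
        rw [Equiv.swap_apply_of_ne_of_ne h1 h2]
      intro i j hij
      rw [← hc i, ← hc j]
      exact hσ hij
    replace hσ : σ ∈ {σ : Equiv.Perm (Fin n) | Antivary c σ} := hσ
    have hmem := vsub_mem_vectorSpan ℝ
      (Set.mem_image_of_mem (fun σ : Equiv.Perm (Fin n) => p + L (a ∘ σ)) hσ)
      (Set.mem_image_of_mem (fun σ : Equiv.Perm (Fin n) => p + L (a ∘ σ)) hτ)
    have hd : a (σ k) - a (σ l) ≠ 0 :=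
      sub_ne_zero.2 fun h => hne (σ.injective (ha.injective h))
    have e : a ∘ σ - a ∘ ((Equiv.swap k l).trans σ) =
        (a (σ k) - a (σ l)) • (Pi.single k 1 - Pi.single l 1 : Fin n → ℝ) := by
      ext j
      rcases eq_or_ne j k with rfl | h1
      · simp [hne]
      rcases eq_or_ne j l with rfl | h2
      · simp [h1]
      simp [Equiv.swap_apply_of_ne_of_ne h1 h2, h1, h2]
    have e2 : (p + L (a ∘ σ)) -ᵥ (p + L (a ∘ ((Equiv.swap k l).trans σ))) =
        (a (σ k) - a (σ l)) • L (Pi.single k 1 - Pi.single l 1) := by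
      rw [vsub_eq_sub, add_sub_add_left_eq_sub, ← map_sub, e, map_smul]
    simp only [e2] at hmem
    have := Submodule.smul_mem _ (a (σ k) - a (σ l))⁻¹ hmem
    rwa [smul_smul, inv_mul_cancel₀ hd, one_smul] at this

/-- Orbit polytopes of vectors with distinct coordinates are normally equivalent. -/
theorem normallyEquivalent_orbit (L : (Fin n → ℝ) →ₗ[ℝ] E) (p q : E) {a b : Fin n → ℝ}
    (ha : StrictMono a) (hb : StrictMono b) :
    NormallyEquivalent
      (convexHull ℝ (Set.range fun σ : Equiv.Perm (Fin n) => p + L (a ∘ σ)))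
      (convexHull ℝ (Set.range fun σ : Equiv.Perm (Fin n) => q + L (b ∘ σ))) := by
  apply normallyEquivalent_convexHull_range
  · intro u
    rw [minIdx_orbit L p ha, minIdx_orbit L q hb]
  · intro u
    rw [minIdx_orbit L p ha, minIdx_orbit L q hb, vectorSpan_orbit L p ha, vectorSpan_orbit L q hb]

end Orbits

/-! ### The fiber polytope of the cube over a segment -/

section Fiber

variable {n : ℕ}

theorem deltaStar_apply (x : Fin n → ℝ) : deltaStar ℝ n x = ∑ k, x k := by
  simp [deltaStar]

/-- The function that is `0` up to `j`, increases linearly to `1` at `j + 1` and stays there. -/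
def ramp (j y : ℝ) : ℝ := max (y - j) 0 - max (y - (j + 1)) 0

theorem continuous_ramp (j : ℝ) : Continuous (ramp j) := by
  unfold ramp
  fun_prop

theorem ramp_of_le {j y : ℝ} (h : y ≤ j) : ramp j y = 0 := by
  rw [ramp, max_eq_right (by linarith), max_eq_right (by linarith), sub_zero]

theorem ramp_of_ge {j y : ℝ} (h : j + 1 ≤ y) : ramp j y = 1 := by
  rw [ramp, max_eq_left (by linarith), max_eq_left (by linarith)]
  ring

theorem ramp_mem (j y : ℝ) : ramp j y ∈ Delta1 := by
  unfold ramp Delta1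
  constructor <;> rcases max_cases (y - j) 0 with h | h <;>
    rcases max_cases (y - (j + 1)) 0 with h' | h' <;> linarith [h.1, h.2, h'.1, h'.2]

/-- The sum telescopes to `max y 0 - max (y - n) 0`. -/
theorem sum_ramp {y : ℝ} (hy : y ∈ Set.Icc (0 : ℝ) n) : ∑ k : Fin n, ramp (k : ℕ) y = y := by
  have h := Finset.sum_range_sub' (fun k : ℕ => max (y - k) 0) n
  rw [Fin.sum_univ_eq_sum_range (fun k => ramp (k : ℕ) y)]
  simp only [Nat.cast_add, Nat.cast_one, Nat.cast_zero, sub_zero] at h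
  unfold ramp
  rw [h, max_eq_left hy.1, max_eq_right (by linarith [hy.2]), sub_zero]

theorem integral_max_sub {j b : ℝ} (hj : 0 ≤ j) (hjb : j ≤ b) :
    ∫ y in (0 : ℝ)..b, max (y - j) 0 = (b - j) ^ 2 / 2 := by
  have hc : Continuous fun y : ℝ => max (y - j) 0 := by fun_prop
  rw [← intervalIntegral.integral_add_adjacent_intervals (b := j) (hc.intervalIntegrable _ _)
    (hc.intervalIntegrable _ _)]
  have h1 : ∫ y in (0 : ℝ)..j, max (y - j) 0 = ∫ y in (0 : ℝ)..j, (0 : ℝ) := by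
    refine intervalIntegral.integral_congr fun y hy => ?_
    rw [Set.uIcc_of_le hj] at hy
    exact max_eq_right (by linarith [hy.2])
  have h2 : ∫ y in j..b, max (y - j) 0 = ∫ y in j..b, (y - j) := by
    refine intervalIntegral.integral_congr fun y hy => ?_
    rw [Set.uIcc_of_le hjb] at hy
    exact max_eq_left (by linarith [hy.1])
  rw [h1, h2, intervalIntegral.integral_comp_sub_right (fun y => y)]
  simp

theorem setIntegral_ramp {j : ℕ} (hj : j < n) :
    ∫ y in Set.Icc (0 : ℝ) n, ramp j y = n - j - 1 / 2 := by
  have hj' : (j : ℝ) + 1 ≤ n := by exact_mod_cast hj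
  have h0 : (0 : ℝ) ≤ j := j.cast_nonneg
  rw [MeasureTheory.integral_Icc_eq_integral_Ioc,
    ← intervalIntegral.integral_of_le (Nat.cast_nonneg n)]
  unfold ramp
  rw [intervalIntegral.integral_sub, integral_max_sub h0 (by linarith),
    integral_max_sub (by linarith) hj']
  · ring
  · exact Continuous.intervalIntegrable (by fun_prop) _ _
  · exact Continuous.intervalIntegrable (by fun_prop) _ _

theorem image_deltaStar_cube :
    deltaStar ℝ n '' (Set.univ.pi fun _ => Delta1) = Set.Icc (0 : ℝ) n := by
  ext y
  constructor
  · rintro ⟨x, hx, rfl⟩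
    rw [deltaStar_apply]
    refine ⟨Finset.sum_nonneg fun k _ => (hx k trivial).1, ?_⟩
    calc ∑ k, x k ≤ ∑ _k : Fin n, (1 : ℝ) := Finset.sum_le_sum fun k _ => (hx k trivial).2
      _ = n := by simp
  · intro hy
    refine ⟨fun k => ramp (k : ℕ) y, fun k _ => ramp_mem _ _, ?_⟩
    rw [deltaStar_apply, sum_ramp hy]

/-- The monotone edge path of the cube that fills the coordinates in the order opposite to
that of the values of `σ`. -/
def cubePath (σ : Equiv.Perm (Fin n)) (y : ℝ) (k : Fin n) : ℝ := ramp ((σ k).rev : ℕ) y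

theorem continuous_cubePath (σ : Equiv.Perm (Fin n)) : Continuous (cubePath σ) :=
  continuous_pi fun _ => continuous_ramp _

theorem sum_cubePath (σ : Equiv.Perm (Fin n)) {y : ℝ} (hy : y ∈ Set.Icc (0 : ℝ) n) :
    ∑ k, cubePath σ y k = y :=
  (Equiv.sum_comp (σ.trans Fin.revPerm) fun k => ramp (k : ℕ) y).trans (sum_ramp hy)

theorem integral_pi_apply {γ : ℝ → Fin n → ℝ} {s : Set ℝ}
    (h : MeasureTheory.IntegrableOn γ s) (k : Fin n) :
    (∫ y in s, γ y) k = ∫ y in s, γ y k :=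
  ((ContinuousLinearMap.proj (R := ℝ) (φ := fun _ : Fin n => ℝ) k).integral_comp_comm h).symm

theorem integral_cubePath (σ : Equiv.Perm (Fin n)) :
    ∫ y in Set.Icc (0 : ℝ) n, cubePath σ y = fun k => ((σ k : ℕ) : ℝ) + 1 / 2 := by
  ext k
  rw [integral_pi_apply (continuous_cubePath σ).continuousOn.integrableOn_Icc]
  unfold cubePath
  rw [setIntegral_ramp (σ k).rev.isLt, Fin.val_rev, Nat.cast_sub (σ k).isLt]
  push_cast
  ring

/-- Among the points of a fiber of the cube, the edge path opposite to `c` minimizes the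
functional with coefficients `c`. -/
theorem sum_mul_cubePath_le {c : Fin n → ℝ} {σ : Equiv.Perm (Fin n)} (hσ : Antivary c σ)
    {y : ℝ} (hy : y ∈ Set.Icc (0 : ℝ) n) {z : Fin n → ℝ} (hz : ∀ k, z k ∈ Delta1)
    (hzy : ∑ k, z k = y) : ∑ k, c k * cubePath σ y k ≤ ∑ k, c k * z k := by
  rcases n.eq_zero_or_pos with rfl | hn
  · simp
  -- The stage of the path at `y` is the floor of `y`, except at the endpoint `y = n`, which belongs
  -- to the last stage `n - 1`.
  obtain ⟨j, hj1, hj2⟩ : ∃ j : Fin n, ((j : ℕ) : ℝ) ≤ y ∧ y ≤ (j : ℕ) + 1 := by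
    rcases hy.2.eq_or_lt with h | h
    · refine ⟨⟨n - 1, by omega⟩, ?_⟩
      rw [h, Nat.cast_sub hn]
      constructor <;> push_cast <;> linarith
    · exact ⟨⟨⌊y⌋₊, (Nat.floor_lt hy.1).2 h⟩, Nat.floor_le hy.1, (Nat.lt_floor_add_one y).le⟩
  -- `l` is the coordinate being filled at `y`: those with larger `σ` are already `1`, those with
  -- smaller `σ` still `0`. Its cost `c l` serves as the threshold of the greedy argument.
  set l := σ.symm j.rev with hl
  have hσl : (σ l).rev = j := by simp [hl]
  have key : ∀ k, 0 ≤ (c k - c l) * (z k - cubePath σ y k) := by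
    intro k
    rcases lt_trichotomy (σ k) (σ l) with h | h | h
    · have h1 : c l ≤ c k := hσ h
      have h2 : cubePath σ y k = 0 := by
        refine ramp_of_le (hj2.trans ?_)
        have : j < (σ k).rev := by rw [← hσl]; exact Fin.rev_lt_rev.2 h
        exact_mod_cast this
      rw [h2, sub_zero]
      exact mul_nonneg (sub_nonneg.2 h1) (hz k).1
    · rw [σ.injective h, sub_self, zero_mul]
    · have h1 : c k ≤ c l := hσ h
      have h2 : cubePath σ y k = 1 := by
        refine ramp_of_ge (le_trans ?_ hj1)
        have : (σ k).rev < j := by rw [← hσl]; exact Fin.rev_lt_rev.2 h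
        exact_mod_cast this
      rw [h2]
      exact mul_nonneg_of_nonpos_of_nonpos (sub_nonpos.2 h1) (sub_nonpos.2 (hz k).2)
  have h := Finset.sum_nonneg fun k (_ : k ∈ Finset.univ) => key k
  -- Both points have coordinate sum `y`, so subtracting the constant `c l` from the costs does not
  -- change their comparison.
  have e : ∑ k, (c k - c l) * (z k - cubePath σ y k) =
      ∑ k, c k * z k - ∑ k, c k * cubePath σ y k - c l * (∑ k, z k - ∑ k, cubePath σ y k) := by
    rw [mul_sub, Finset.mul_sum, Finset.mul_sum, ← Finset.sum_sub_distrib,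
      ← Finset.sum_sub_distrib, ← Finset.sum_sub_distrib]
    exact Finset.sum_congr rfl fun k _ => by ring
  rw [e, hzy, sum_cubePath σ hy, sub_self, mul_zero, sub_zero] at h
  linarith

theorem convex_fiberPolytope_cube :
    Convex ℝ (fiberPolytope (deltaStar ℝ n) (Set.univ.pi fun _ => Delta1)) := by
  unfold fiberPolytope
  rw [image_deltaStar_cube]
  rintro _ ⟨γ, hγ, hγ', rfl⟩ _ ⟨η, hη, hη', rfl⟩ α β hα hβ hαβ
  refine ⟨α • γ + β • η, (hγ.const_smul α).add (hη.const_smul β), fun y hy => ⟨?_, ?_⟩, ?_⟩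
  · exact convex_pi (fun _ _ => convex_Icc 0 1) (hγ' y hy).1 (hη' y hy).1 hα hβ hαβ
  · simp only [Pi.add_apply, Pi.smul_apply, map_add, map_smul, (hγ' y hy).2, (hη' y hy).2]
    rw [← add_smul, hαβ, one_smul]
  · simp only [Pi.add_apply]
    rw [MeasureTheory.integral_add (hγ.integrableOn_Icc.smul α) (hη.integrableOn_Icc.smul β)]
    simp only [Pi.smul_apply, MeasureTheory.integral_smul]

/-- The fiber polytope of the sum map on the cube is a permutohedron. -/
theorem fiberPolytope_cube :
    fiberPolytope (deltaStar ℝ n) (Set.univ.pi fun _ => Delta1) =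
      convexHull ℝ (Set.range fun (σ : Equiv.Perm (Fin n)) (k : Fin n) =>
        ((σ k : ℕ) : ℝ) + 1 / 2) := by
  apply Set.Subset.antisymm
  · rintro x hx
    by_contra hcon
    -- A separating functional would take a smaller value at the integral of some section than at
    -- that of every edge path, including the path optimal for it.
    obtain ⟨f, s, hfx, hfs⟩ := geometric_hahn_banach_point_closed (convex_convexHull ℝ _)
      ((Set.finite_range _).isClosed_convexHull ℝ) hcon
    unfold fiberPolytope at hx
    rw [image_deltaStar_cube] at hx
    obtain ⟨γ, hγ, hγ', rfl⟩ := hx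
    obtain ⟨σ, hσ⟩ := exists_perm_antivary fun k => f (Pi.single k 1)
    have hσ' := hfs _ (subset_convexHull ℝ _ ⟨σ, rfl⟩)
    simp only [← integral_cubePath] at hσ'
    have hi := (continuous_cubePath σ).continuousOn.integrableOn_Icc (μ := MeasureTheory.volume)
      (a := (0 : ℝ)) (b := n)
    have hi' := hγ.integrableOn_Icc (μ := MeasureTheory.volume)
    have hle : f (∫ y in Set.Icc (0 : ℝ) n, cubePath σ y) ≤ f (∫ y in Set.Icc (0 : ℝ) n, γ y) := by
      rw [← f.integral_comp_comm hi, ← f.integral_comp_comm hi']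
      refine MeasureTheory.setIntegral_mono_on (f.integrable_comp hi) (f.integrable_comp hi')
        measurableSet_Icc fun y hy => ?_
      have hf : ∀ z, f z = ∑ k, f (Pi.single k 1) * z k :=
        dual_apply_eq_sum LinearMap.id (f : (Fin n → ℝ) →ₗ[ℝ] ℝ)
      rw [hf, hf (γ y)]
      refine sum_mul_cubePath_le hσ hy (fun k => (hγ' y hy).1 k trivial) ?_
      rw [← deltaStar_apply, (hγ' y hy).2]
    linarith
  · refine convexHull_min ?_ convex_fiberPolytope_cube
    rintro _ ⟨σ, rfl⟩
    unfold fiberPolytope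
    rw [image_deltaStar_cube]
    refine ⟨cubePath σ, (continuous_cubePath σ).continuousOn, fun y hy => ⟨?_, ?_⟩, ?_⟩
    · exact fun k _ => ramp_mem _ _
    · rw [deltaStar_apply, sum_cubePath σ hy]
    · rw [integral_cubePath]

/-- The vertices of `Q(Δ₁, n)`. -/
def permVertex (σ : Equiv.Perm (Fin n)) : charSpace ℝ n :=
  ⟨fun k => ((σ k : ℕ) : ℝ) + 1 / 2 - n / 2, by
    rw [LinearMap.mem_ker, deltaStar_apply]
    rcases n.eq_zero_or_pos with rfl | hn
    · simp
    rw [Finset.sum_sub_distrib, Finset.sum_add_distrib,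
      Equiv.sum_comp σ (fun k => ((k : ℕ) : ℝ)), Fin.sum_univ_eq_sum_range (fun k => (k : ℝ)),
      ← Nat.cast_sum, Finset.sum_range_id, Nat.cast_div (Nat.even_mul_pred_self n).two_dvd
        two_ne_zero, Nat.cast_mul, Nat.cast_sub hn]
    simp
    ring⟩

theorem coe_image_convexHull_permVertex :
    ((↑) : charSpace ℝ n → Fin n → ℝ) '' convexHull ℝ (Set.range permVertex) =
      convexHull ℝ (Set.range fun (σ : Equiv.Perm (Fin n)) (k : Fin n) =>
        ((σ k : ℕ) : ℝ) + 1 / 2 - n / 2) := by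
  rw [← Submodule.coe_subtype, LinearMap.image_convexHull, ← Set.range_comp]
  rfl

theorem polyQ_Delta1 (hn : n ≠ 0) :
    polyQ Delta1 n = convexHull ℝ (Set.range (permVertex (n := n))) := by
  have hn' : (n : ℝ) ≠ 0 := Nat.cast_ne_zero.2 hn
  -- The centering vector of `polyQ` is the `n / 2` of the statement.
  have hc : (n : ℝ)⁻¹ • ∫ y in Set.Icc (0 : ℝ) n, y = n / 2 := by
    rw [MeasureTheory.integral_Icc_eq_integral_Ioc,
      ← intervalIntegral.integral_of_le (Nat.cast_nonneg n), integral_id]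
    simp
    field_simp
  ext x
  rw [← Subtype.val_injective.mem_set_image (s := convexHull ℝ _),
    coe_image_convexHull_permVertex]
  simp only [polyQ, image_deltaStar_cube, hc, fiberPolytope_cube, Set.mem_ofPred_eq]
  have e : (Set.range fun (σ : Equiv.Perm (Fin n)) (k : Fin n) => ((σ k : ℕ) : ℝ) + 1 / 2) =
      (fun _ => (n : ℝ) / 2 : Fin n → ℝ) +ᵥ
        Set.range fun (σ : Equiv.Perm (Fin n)) (k : Fin n) => ((σ k : ℕ) : ℝ) + 1 / 2 - n / 2 := by
    rw [Set.vadd_set_range]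
    congr 1
    ext σ k
    simp
  rw [e, convexHull_vadd, add_comm, ← vadd_eq_add, Set.vadd_mem_vadd_set_iff]

end Fiber

/-! ### Coordinates on the space of vectors with sum zero -/

section Coordinates

variable {m : ℕ}

theorem charSpace_sum_eq_zero {n : ℕ} (x : charSpace ℝ n) : ∑ k, (x : Fin n → ℝ) k = 0 := by
  rw [← deltaStar_apply]
  exact x.2

/-- The vector whose `i`-th coordinate balances the sum of the other, given ones. -/
def balanceVec (i : Fin (m + 1)) (x : Fin m → ℝ) : Fin (m + 1) → ℝ :=
  i.insertNth (α := fun _ => ℝ) (-∑ k, x k) x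

theorem balanceVec_self (i : Fin (m + 1)) (x : Fin m → ℝ) : balanceVec i x i = -∑ k, x k :=
  Fin.insertNth_apply_same (α := fun _ => ℝ) i _ x

theorem balanceVec_succAbove (i : Fin (m + 1)) (x : Fin m → ℝ) (k : Fin m) :
    balanceVec i x (i.succAbove k) = x k :=
  Fin.insertNth_apply_succAbove (α := fun _ => ℝ) i _ x k

theorem balanceVec_mem (i : Fin (m + 1)) (x : Fin m → ℝ) :
    balanceVec i x ∈ charSpace ℝ (m + 1) := by
  rw [LinearMap.mem_ker, deltaStar_apply, Fin.sum_univ_succAbove _ i, balanceVec_self]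
  simp only [balanceVec_succAbove, neg_add_cancel]

theorem balanceVec_add (i : Fin (m + 1)) (x y : Fin m → ℝ) :
    balanceVec i (x + y) = balanceVec i x + balanceVec i y := by
  ext j
  refine Fin.succAboveCases i ?_ (fun k => ?_) j
  · rw [Pi.add_apply]
    simp only [balanceVec_self, Pi.add_apply, Finset.sum_add_distrib, neg_add]
  · rw [Pi.add_apply]
    simp only [balanceVec_succAbove, Pi.add_apply]

theorem balanceVec_smul (i : Fin (m + 1)) (c : ℝ) (x : Fin m → ℝ) :
    balanceVec i (c • x) = c • balanceVec i x := by
  ext j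
  refine Fin.succAboveCases i ?_ (fun k => ?_) j
  · rw [Pi.smul_apply]
    simp only [balanceVec_self, Pi.smul_apply, smul_eq_mul, ← Finset.mul_sum, mul_neg]
  · rw [Pi.smul_apply]
    simp only [balanceVec_succAbove, Pi.smul_apply]

/-- The vector with coordinate sum zero whose coordinates other than the `i`-th are given. -/
def balance (i : Fin (m + 1)) : (Fin m → ℝ) →ₗ[ℝ] charSpace ℝ (m + 1) where
  toFun x := ⟨balanceVec i x, balanceVec_mem i x⟩
  map_add' x y := Subtype.ext (balanceVec_add i x y)
  map_smul' c x := Subtype.ext (balanceVec_smul i c x)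

theorem balance_apply_self (i : Fin (m + 1)) (x : Fin m → ℝ) :
    (balance i x : Fin (m + 1) → ℝ) i = -∑ k, x k :=
  balanceVec_self i x

theorem balance_apply_succAbove (i : Fin (m + 1)) (x : Fin m → ℝ) (k : Fin m) :
    (balance i x : Fin (m + 1) → ℝ) (i.succAbove k) = x k :=
  balanceVec_succAbove i x k

/-- Sum zero determines the `i`-th coordinate, so identities in `charSpace` need checking only off
`i`. -/
theorem eq_balance_iff (i : Fin (m + 1)) (x : charSpace ℝ (m + 1)) (y : Fin m → ℝ) :
    x = balance i y ↔ ∀ k, (x : Fin (m + 1) → ℝ) (i.succAbove k) = y k := by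
  constructor
  · rintro rfl k
    exact balance_apply_succAbove i y k
  · intro h
    ext j
    refine Fin.succAboveCases i ?_ (fun k => ?_) j
    · have hx := charSpace_sum_eq_zero x
      rw [Fin.sum_univ_succAbove _ i] at hx
      rw [balance_apply_self, ← Finset.sum_congr rfl fun k _ => h k]
      linarith
    · rw [h, balance_apply_succAbove]

theorem cayleyProj_apply (i : Fin (m + 1)) (x : charSpace ℝ (m + 1)) :
    cayleyProj i x = ∑ k, (x : Fin (m + 1) → ℝ) (i.succAbove k) := by
  simp [cayleyProj, deltaStar_apply, LinearMap.funLeft_apply]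

theorem cayleyProj_balance (i : Fin (m + 1)) (x : Fin m → ℝ) :
    cayleyProj i (balance i x) = ∑ k, x k := by
  rw [cayleyProj_apply]
  simp only [balance_apply_succAbove]

theorem insertZero_eq_balance (i : Fin (m + 1)) (x : charSpace ℝ m) :
    insertZero i x = balance i x := by
  rw [eq_balance_iff]
  exact fun k => Fin.insertNth_apply_succAbove (α := fun _ => ℝ) i _ _ k

theorem balance_surjective (i : Fin (m + 1)) : Function.Surjective (balance i) := fun x =>
  ⟨fun k => (x : Fin (m + 1) → ℝ) (i.succAbove k), ((eq_balance_iff i x _).2 fun _ => rfl).symm⟩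

theorem balance_injective (i : Fin (m + 1)) : Function.Injective (balance i) := fun x y h => by
  ext k
  rw [← balance_apply_succAbove i x, h, balance_apply_succAbove]

theorem finrank_charSpace : Module.finrank ℝ (charSpace ℝ (m + 1)) = m := by
  rw [← (LinearEquiv.ofBijective (balance (0 : Fin (m + 1)))
    ⟨balance_injective 0, balance_surjective 0⟩).finrank_eq]
  simp

end Coordinates

/-! ### The lattices -/

section Lattices

variable {m : ℕ}

theorem mem_intLattice {x : ℝ} : x ∈ intLattice ↔ ∃ z : ℤ, (z : ℝ) = x := by
  simp [intLattice]

theorem natCast_mem_intLattice (z : ℕ) : (z : ℝ) ∈ intLattice := mem_intLattice.2 ⟨z, by simp⟩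

theorem one_le_abs_sub_of_mem_intLattice {x y : ℝ} (hx : x ∈ intLattice) (hy : y ∈ intLattice)
    (h : x ≠ y) : 1 ≤ |x - y| := by
  obtain ⟨a, rfl⟩ := mem_intLattice.1 hx
  obtain ⟨b, rfl⟩ := mem_intLattice.1 hy
  have : a - b ≠ 0 := sub_ne_zero.2 fun e => h (by rw [e])
  exact_mod_cast Int.one_le_abs this

theorem discreteTopology_intLattice : DiscreteTopology intLattice :=
  .of_forall_le_dist one_pos fun x y hxy =>
    one_le_abs_sub_of_mem_intLattice x.2 y.2 (Subtype.coe_ne_coe.2 hxy)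

theorem span_intLattice : Submodule.span ℝ (intLattice : Set ℝ) = ⊤ := by
  refine eq_top_iff.2 fun x _ => ?_
  have h1 : (1 : ℝ) ∈ intLattice := by simpa using natCast_mem_intLattice 1
  simpa using Submodule.smul_mem _ x (Submodule.subset_span (R := ℝ) h1)

theorem discreteTopology_charLattice (n : ℕ) : DiscreteTopology (charLattice n) := by
  refine .of_forall_le_dist one_pos fun x y hxy => ?_
  obtain ⟨k, hk⟩ : ∃ k, (x : charSpace ℝ n).1 k ≠ (y : charSpace ℝ n).1 k := by
    by_contra! h
    exact hxy (Subtype.ext (Subtype.ext (funext h)))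
  exact (one_le_abs_sub_of_mem_intLattice (x.2 k) (y.2 k) hk).trans
    (dist_le_pi_dist (x : charSpace ℝ n).1 (y : charSpace ℝ n).1 k)

theorem balance_mem_charLattice (i : Fin (m + 1)) {x : Fin m → ℝ} (hx : ∀ k, x k ∈ intLattice) :
    balance i x ∈ charLattice (m + 1) := by
  intro j
  refine Fin.succAboveCases i ?_ (fun k => ?_) j
  · rw [balance_apply_self]
    exact neg_mem (sum_mem fun k _ => hx k)
  · rw [balance_apply_succAbove]
    exact hx k

theorem single_mem_intLattice (k : Fin m) {r : ℝ} (hr : r ∈ intLattice) (l : Fin m) :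
    (Pi.single k r : Fin m → ℝ) l ∈ intLattice := by
  rcases eq_or_ne l k with rfl | h
  · simpa using hr
  · simp [h]

theorem span_charLattice :
    Submodule.span ℝ (charLattice (m + 1) : Set (charSpace ℝ (m + 1))) = ⊤ := by
  refine eq_top_iff.2 fun x _ => ?_
  obtain ⟨y, rfl⟩ := balance_surjective 0 x
  rw [pi_eq_sum_univ' y, map_sum]
  refine sum_mem fun k _ => ?_
  rw [map_smul]
  refine Submodule.smul_mem _ _ (Submodule.subset_span (balance_mem_charLattice 0 ?_))
  exact single_mem_intLattice k (by simpa using natCast_mem_intLattice 1)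

theorem cayleyProj_image_charLattice (hm : 1 ≤ m) (i : Fin (m + 1)) :
    cayleyProj i '' (charLattice (m + 1) : Set (charSpace ℝ (m + 1))) = (intLattice : Set ℝ) := by
  ext r
  constructor
  · rintro ⟨x, hx, rfl⟩
    rw [cayleyProj_apply]
    exact sum_mem fun k _ => hx _
  · intro hr
    -- Here `1 ≤ m` supplies a coordinate other than `i` in which to place `r`.
    refine ⟨balance i (Pi.single ⟨0, hm⟩ r), balance_mem_charLattice i ?_, ?_⟩
    · exact single_mem_intLattice _ hr
    · rw [cayleyProj_balance, Finset.sum_pi_single']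
      simp

end Lattices

/-! ### The permutohedron as a Cayley sum -/

section Cayley

variable {m : ℕ}

theorem polytopeDim_polyQ : polytopeDim (polyQ Delta1 (m + 1)) = m := by
  rw [polyQ_Delta1 m.succ_ne_zero, polytopeDim_convexHull]
  suffices h : vectorSpan ℝ (Set.range (permVertex (n := m + 1))) = ⊤ by
    rw [h, finrank_top, finrank_charSpace]
  refine eq_top_iff.2 fun x _ => ?_
  obtain ⟨y, rfl⟩ := balance_surjective 0 x
  rw [pi_eq_sum_univ' y, map_sum]
  refine sum_mem fun k _ => ?_
  rw [map_smul]
  refine Submodule.smul_mem _ _ ?_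
  have hmem := vsub_mem_vectorSpan ℝ
    (Set.mem_range_self (f := permVertex (n := m + 1)) (Equiv.refl _))
    (Set.mem_range_self (f := permVertex (n := m + 1)) (Equiv.swap 0 k.succ))
  -- Swapping `0` with `k + 1` changes only these two coordinates, by `k + 1` in opposite
  -- directions; these differences already span.
  have e : permVertex (n := m + 1) (Equiv.refl _) -ᵥ permVertex (Equiv.swap 0 k.succ) =
      ((k : ℝ) + 1) • balance 0 (Pi.single k 1) := by
    rw [← map_smul, eq_balance_iff]
    intro l
    rw [Fin.succAbove_zero]
    rcases eq_or_ne l k with rfl | h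
    · simp [permVertex]
    · have : Equiv.swap 0 k.succ l.succ = l.succ :=
        Equiv.swap_apply_of_ne_of_ne (Fin.succ_ne_zero l) fun h' => h (Fin.succ_injective _ h')
      simp [permVertex, this, h]
  rw [e] at hmem
  have hk : (k : ℝ) + 1 ≠ 0 := by positivity
  have := Submodule.smul_mem _ ((k : ℝ) + 1)⁻¹ hmem
  rwa [smul_smul, inv_mul_cancel₀ hk, one_smul] at this

theorem coe_image_polyQ :
    ((↑) : charSpace ℝ (m + 1) → Fin (m + 1) → ℝ) '' polyQ Delta1 (m + 1) =
      (fun _ => -(1 / 2) - ((m + 1 : ℕ) : ℝ) / 2 : Fin (m + 1) → ℝ) +ᵥ permutohedron (m + 1) := by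
  rw [polyQ_Delta1 m.succ_ne_zero, coe_image_convexHull_permVertex, permutohedron,
    ← convexHull_vadd, Set.vadd_set_range]
  congr 2
  ext σ k
  simp only [vadd_eq_add, Pi.add_apply]
  ring

theorem insertZero_image_polyQ (hm : 1 ≤ m) (i : Fin (m + 1)) :
    insertZero i '' polyQ Delta1 m =
      convexHull ℝ (Set.range fun σ : Equiv.Perm (Fin m) =>
        0 + balance i ((fun k : Fin m => ((k : ℕ) : ℝ) + 1 / 2 - m / 2) ∘ σ)) := by
  have h : insertZero i = balance i ∘ₗ (charSpace ℝ m).subtype :=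
    funext fun x => insertZero_eq_balance i x
  rw [polyQ_Delta1 (by omega), h, LinearMap.image_convexHull, ← Set.range_comp]
  congr 2
  ext1 σ
  rw [zero_add]
  rfl

/-- The vector `(1, …, m + 1)` without its entry `j + 1`. -/
def skipVector (j : Fin (m + 1)) (k : Fin m) : ℝ := ((j.succAbove k : ℕ) : ℝ) + 1

theorem skipVector_strictMono (j : Fin (m + 1)) : StrictMono (skipVector j) := fun k l h => by
  have : (j.succAbove k : ℕ) < j.succAbove l := Fin.strictMono_succAbove j h
  have : ((j.succAbove k : ℕ) : ℝ) < (j.succAbove l : ℕ) := by exact_mod_cast this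
  unfold skipVector
  linarith

/-- A vertex of the `j`-th summand: the point whose `i`-th coordinate is `j - m` and whose other
coordinates are a permutation of `(1, …, m + 1)` without `j + 1`, reduced by `(1, …, m)`. -/
def summandVertex (i j : Fin (m + 1)) (τ : Equiv.Perm (Fin m)) : charSpace ℝ (m + 1) :=
  -balance i (fun k => ((k : ℕ) : ℝ) + 1) + balance i (skipVector j ∘ τ)

/-- The summands of the permutohedron as a Cayley sum. -/
def summand (i j : Fin (m + 1)) : Set (charSpace ℝ (m + 1)) :=
  convexHull ℝ (Set.range (summandVertex i j))

theorem summandVertex_eq (i j : Fin (m + 1)) (τ : Equiv.Perm (Fin m)) :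
    summandVertex i j τ =
      balance i (fun k => ((j.succAbove (τ k) : ℕ) : ℝ) - ((k : ℕ) : ℝ)) := by
  rw [summandVertex, ← map_neg, ← map_add]
  congr 1
  ext k
  simp only [skipVector, Pi.add_apply, Pi.neg_apply, Function.comp_apply]
  ring

theorem summandVertex_mem_charLattice (i j : Fin (m + 1)) (τ : Equiv.Perm (Fin m)) :
    summandVertex i j τ ∈ charLattice (m + 1) := by
  rw [summandVertex_eq]
  exact balance_mem_charLattice i fun k =>
    sub_mem (natCast_mem_intLattice _) (natCast_mem_intLattice _)

theorem cayleyProj_summandVertex (i j : Fin (m + 1)) (τ : Equiv.Perm (Fin m)) :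
    cayleyProj i (summandVertex i j τ) = m - (j : ℕ) := by
  rw [summandVertex_eq, cayleyProj_balance, Finset.sum_sub_distrib,
    Equiv.sum_comp τ fun k => ((j.succAbove k : ℕ) : ℝ)]
  -- The total `0 + … + m` is split in two ways, removing `j` or removing `m`; the two remainders
  -- differ by `m - j`.
  have h1 := Fin.sum_univ_succAbove (fun k : Fin (m + 1) => ((k : ℕ) : ℝ)) j
  have h2 := Fin.sum_univ_castSucc (fun k : Fin (m + 1) => ((k : ℕ) : ℝ))
  simp only [Fin.val_castSucc, Fin.val_last] at h2
  linarith

theorem cayleyProj_image_summand (i j : Fin (m + 1)) :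
    cayleyProj i '' summand i j = {(m : ℝ) - (j : ℕ)} := by
  rw [summand, LinearMap.image_convexHull, ← Set.range_comp,
    show cayleyProj i ∘ summandVertex i j = fun _ => (m : ℝ) - (j : ℕ) from
      funext fun τ => cayleyProj_summandVertex i j τ, Set.range_const, convexHull_singleton]

theorem isLatticePolytope_summand (i j : Fin (m + 1)) :
    IsLatticePolytope (charLattice (m + 1)) (summand i j) := by
  classical
  refine ⟨Finset.univ.image (summandVertex i j), Finset.univ_nonempty.image _, fun x hx => ?_, ?_⟩
  · obtain ⟨τ, -, rfl⟩ := Finset.mem_image.1 hx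
    exact summandVertex_mem_charLattice i j τ
  · simp [summand]

/-- The permutation of `m + 1` letters that maps `i` to `j` and is given by `τ` on the others. -/
def extendPerm (i j : Fin (m + 1)) (τ : Equiv.Perm (Fin m)) : Equiv.Perm (Fin (m + 1)) :=
  (finSuccEquiv' i).trans ((Equiv.optionCongr τ).trans (finSuccEquiv' j).symm)

theorem extendPerm_succAbove (i j : Fin (m + 1)) (τ : Equiv.Perm (Fin m)) (k : Fin m) :
    extendPerm i j τ (i.succAbove k) = j.succAbove (τ k) := by
  simp [extendPerm]

theorem exists_perm_succAbove (i : Fin (m + 1)) (σ : Equiv.Perm (Fin (m + 1))) :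
    ∃ τ : Equiv.Perm (Fin m), ∀ k, σ (i.succAbove k) = (σ i).succAbove (τ k) := by
  have h : ∀ k, ∃ l, (σ i).succAbove l = σ (i.succAbove k) := fun k =>
    Fin.exists_succAbove_eq fun e => Fin.succAbove_ne i k (σ.injective e)
  choose f hf using h
  have hinj : Function.Injective f := fun k l hkl => by
    have : σ (i.succAbove k) = σ (i.succAbove l) := by rw [← hf, ← hf, hkl]
    exact Fin.succAbove_right_injective (σ.injective this)
  exact ⟨Equiv.ofBijective f (Finite.injective_iff_bijective.1 hinj), fun k => (hf k).symm⟩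

/-- The translation that moves `Q(Δ₁, m + 1)` to the Cayley sum. -/
def cayleyShift (i : Fin (m + 1)) : charSpace ℝ (m + 1) :=
  balance i fun k => (m : ℝ) / 2 - ((k : ℕ) : ℝ)

/-- Vertices of `Q(Δ₁, m + 1)` have coordinates `σ k - m / 2`. The shift cancels `m / 2` off `i`,
making the vertices integral, and subtracts `(0, …, m - 1)` there, which brings the projections into
`[0, m]`. -/
theorem cayleyShift_add_permVertex (i : Fin (m + 1)) {σ : Equiv.Perm (Fin (m + 1))}
    {τ : Equiv.Perm (Fin m)} {j : Fin (m + 1)}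
    (h : ∀ k, σ (i.succAbove k) = j.succAbove (τ k)) :
    cayleyShift i + permVertex σ = summandVertex i j τ := by
  rw [summandVertex_eq, eq_balance_iff]
  intro k
  rw [Submodule.coe_add, Pi.add_apply, cayleyShift, balance_apply_succAbove]
  simp only [permVertex, h]
  push_cast
  ring

theorem cayleyShift_vadd_polyQ (i : Fin (m + 1)) :
    cayleyShift i +ᵥ polyQ Delta1 (m + 1) = convexHull ℝ (⋃ j, summand i j) := by
  have h : Set.range (fun σ : Equiv.Perm (Fin (m + 1)) => cayleyShift i +ᵥ permVertex σ) =
      ⋃ j, Set.range (summandVertex i j) := by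
    ext x
    simp only [Set.mem_iUnion, Set.mem_range, vadd_eq_add]
    constructor
    · rintro ⟨σ, rfl⟩
      obtain ⟨τ, hτ⟩ := exists_perm_succAbove i σ
      -- The summand containing a vertex is read off from the value of `σ` at `i`.
      exact ⟨σ i, τ, (cayleyShift_add_permVertex i hτ).symm⟩
    · rintro ⟨j, τ, rfl⟩
      exact ⟨extendPerm i j τ, cayleyShift_add_permVertex i (extendPerm_succAbove i j τ)⟩
  rw [polyQ_Delta1 m.succ_ne_zero, ← convexHull_vadd, Set.vadd_set_range, h]
  apply Set.Subset.antisymm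
  · exact convexHull_mono (Set.iUnion_mono fun j => subset_convexHull ℝ _)
  · exact convexHull_min (Set.iUnion_subset fun j => convexHull_mono
      (Set.subset_iUnion (fun j => Set.range (summandVertex i j)) j))
      (convex_convexHull ℝ _)

theorem smul_Delta1 : (m : ℝ) • Delta1 = Set.Icc (0 : ℝ) m := by
  ext x
  simp only [Delta1, Set.mem_smul_set, Set.mem_Icc, smul_eq_mul]
  rcases m.eq_zero_or_pos with rfl | hm
  · simp only [Nat.cast_zero, zero_mul]
    exact ⟨by rintro ⟨_, -, rfl⟩; simp, fun h => ⟨0, by simp, le_antisymm h.1 h.2⟩⟩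
  · have hm' : (0 : ℝ) < m := Nat.cast_pos.2 hm
    constructor
    · rintro ⟨y, ⟨h0, h1⟩, rfl⟩
      exact ⟨by positivity, by nlinarith⟩
    · rintro ⟨h0, h1⟩
      exact ⟨x / m, ⟨by positivity, (div_le_one hm').2 h1⟩, by field_simp⟩

theorem smul_Delta1_eq_convexHull :
    (m : ℝ) • Delta1 = convexHull ℝ (Set.range fun j : Fin (m + 1) => (m : ℝ) - (j : ℕ)) := by
  rw [smul_Delta1]
  apply Set.Subset.antisymm
  · rw [← segment_eq_Icc (Nat.cast_nonneg m)]
    exact segment_subset_convexHull ⟨Fin.last m, by simp⟩ ⟨0, by simp⟩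
  · refine convexHull_min ?_ (convex_Icc _ _)
    rintro _ ⟨j, rfl⟩
    have : ((j : ℕ) : ℝ) ≤ m := by exact_mod_cast j.is_le
    exact ⟨by linarith, by simp⟩

theorem normallyEquivalent_summand (i j l : Fin (m + 1)) :
    NormallyEquivalent (summand i j) (summand i l) :=
  normallyEquivalent_orbit (balance i) _ _ (skipVector_strictMono j) (skipVector_strictMono l)

/-- The inserted `Q(Δ₁, m)` is also an orbit polytope under `balance i`: its generating vector has
sum zero, so balancing inserts a zero. -/
theorem normallyEquivalent_summand_polyQ (hm : 1 ≤ m) (i j : Fin (m + 1)) :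
    NormallyEquivalent (summand i j) (insertZero i '' polyQ Delta1 m) := by
  rw [insertZero_image_polyQ hm]
  refine normallyEquivalent_orbit (balance i) _ _ (skipVector_strictMono j) fun k l h => ?_
  have : ((k : ℕ) : ℝ) < (l : ℕ) := by exact_mod_cast h
  linarith

theorem setOf_cayleyProj_image_summand (i : Fin (m + 1)) :
    {y : ℝ | ∃ j, cayleyProj i '' summand i j = {y}} =
      ((m : ℝ) • Delta1) ∩ Set.range ((↑) : ℤ → ℝ) := by
  rw [smul_Delta1]
  ext y
  simp only [cayleyProj_image_summand, Set.singleton_eq_singleton_iff, Set.mem_ofPred_eq]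
  constructor
  · rintro ⟨j, rfl⟩
    have : ((j : ℕ) : ℝ) ≤ m := by exact_mod_cast j.is_le
    exact ⟨⟨by linarith, by simp⟩, (m : ℤ) - (j : ℕ), by simp⟩
  · rintro ⟨⟨h0, h1⟩, z, rfl⟩
    have h0' : 0 ≤ z := by exact_mod_cast h0
    have h1' : z ≤ m := by exact_mod_cast h1
    lift z to ℕ using h0'
    have h2 : z ≤ m := by exact_mod_cast h1'
    refine ⟨⟨m - z, by omega⟩, ?_⟩
    rw [Nat.cast_sub h2]
    simp

end Cayley

end

theorem mainTheorem6 (m : ℕ) (hm : 1 ≤ m) :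
    -- `Q(Δ₁, m+1)` is the `m`-dimensional permutohedron
    polytopeDim (polyQ Delta1 (m + 1)) = m ∧
    (∃ t : Fin (m + 1) → ℝ,
      ((↑) : charSpace ℝ (m + 1) → Fin (m + 1) → ℝ) '' polyQ Delta1 (m + 1)
        = t +ᵥ permutohedron (m + 1)) ∧
    -- and, for each of the projections `π_i`, it is a generalized Cayley sum as claimed
    ∀ i : Fin (m + 1),
      ∃ (t : charSpace ℝ (m + 1)) (R : Fin (m + 1) → Set (charSpace ℝ (m + 1))),
        IsGenTwistedCayleySum (charLattice (m + 1)) intLattice (cayleyProj i) R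
          (t +ᵥ polyQ Delta1 (m + 1)) ((m : ℝ) • Delta1) ∧
        (∀ j, NormallyEquivalent (R j) (insertZero i '' polyQ Delta1 m)) ∧
        {y : ℝ | ∃ j, cayleyProj i '' R j = {y}} =
          ((m : ℝ) • Delta1) ∩ Set.range ((↑) : ℤ → ℝ) := by
  refine ⟨polytopeDim_polyQ, ⟨_, coe_image_polyQ⟩, fun i => ⟨cayleyShift i, summand i, ?_,
    normallyEquivalent_summand_polyQ hm i, setOf_cayleyProj_image_summand i⟩⟩
  exact
    { discrete_M := discreteTopology_charLattice _
      span_M := span_charLattice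
      discrete_Λ := discreteTopology_intLattice
      span_Λ := span_intLattice
      map_eq := cayleyProj_image_charLattice hm i
      isLatticePolytope := isLatticePolytope_summand i
      normallyEquivalent := normallyEquivalent_summand i
      total := cayleyShift_vadd_polyQ i
      base := ⟨fun j => (m : ℝ) - (j : ℕ),
        fun j => ⟨sub_mem (natCast_mem_intLattice _) (natCast_mem_intLattice _),
          cayleyProj_image_summand i j⟩, smul_Delta1_eq_convexHull⟩ }
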